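/- \textbf{Theorem (General Central Limit Theorem).} For each $n\ge 1$ let $v=v_n=(v_{1},\dots,v_{n})'$ be a random vector whose components are independent and identically distributed with mean $0$ and variance $1$, and suppose that for some $s\ge 8$ and some constant $C<\infty$ not depending on $n$ or $i$, $\mathrm{E}|v_i|^s\le C$. Let $B=(b_{ij})$ be a non-random real $n\times n$ matrix (possibly depending on $n$) whose absolute row and column sums are bounded uniformly in $n$: $\sup_{n}\max_{i}\sum_{j=1}^n|b_{ij}|+\sup_n\max_{j}\sum_{i=1}^n|b_{ij}|<\infty$. Let $\mathscr S=(s_{ij})$ be a real symmetric $n\times n$ matrix, which is either non-random or random and independent of $v$, and suppose that $$\mathscr A=B'\mathscr S B$$ is (almost surely) symmetric and idempotent with rank $J=J_n$, where $J_n$ is a non-random integer. Assume that, as $n\to\infty$, $$\max_{1\le i,j\le n}|s_{ij}|=O_p(J/n),\qquad \max_{1\le j\le n}\sum_{i=1}^n s_{ij}^2=O_p(J/n),\qquad \overline\alpha(\mathscr S)=O_p(1),$$ where $\overline\alpha(\mathscr S)$ denotes the largest eigenvalue of $\mathscr S$, and where $X_n=O_p(r_n)$ means that for every $\varepsilon>0$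 there is $M<\infty$ with $\mathrm{P}(|X_n|>M r_n)\le\varepsilon$ for all sufficiently large $n$. If $J^{-1}+J^3/n\to 0$ as $n\to\infty$, then $$\frac{v'\mathscr A v-J}{\sqrt{2J}}\;\overset{d}{\longrightarrow}\;N(0,1).$$ -/

import Mathlib

open MeasureTheory ProbabilityTheory Filter Topology
open scoped NNReal ENNReal Matrix

/-- Uniform `O_p`: for random arrays `X n i`, where `i` runs over an index set `I n` that may grow
with `n`, this says `sup_i |X n i| = O_p(r n)`, that is, for every `ε > 0` there is `M` such that
`P (∃ i, |X n i| > M * r n) ≤ ε` for all large `n`. -/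
def IsBigOInProbUnif {Ω : ℕ → Type*} [∀ n, MeasurableSpace (Ω n)] (P : ∀ n, Measure (Ω n))
    {I : ℕ → Type*} (X : ∀ n, I n → Ω n → ℝ) (r : ℕ → ℝ) : Prop :=
  ∀ ε : ℝ≥0∞, 0 < ε → ∃ M : ℝ, ∀ᶠ n in atTop, P n {ω | ∃ i : I n, M * r n < |X n i ω|} ≤ ε

/-- `X n = O_p(r n)` for a sequence of random variables. -/
def IsBigOInProb {Ω : ℕ → Type*} [∀ n, MeasurableSpace (Ω n)] (P : ∀ n, Measure (Ω n))
    (X : ∀ n, Ω n → ℝ) (r : ℕ → ℝ) : Prop :=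
  IsBigOInProbUnif P (I := fun _ => Unit) (fun n _ => X n) r

/-- The largest eigenvalue of a real symmetric matrix: the maximum of its (finite, real)
spectrum. -/
noncomputable def largestEigenvalue {n : ℕ} (A : Matrix (Fin n) (Fin n) ℝ) : ℝ :=
  sSup (spectrum ℝ A)

/-!
The characteristic function of `(v'Av - J) / √(2J)` is compared with that of the same expression in
independent standard Gaussian variables, by Lindeberg's replacement method, conditionally on `S`.

For a fixed projection `A` of rank `J` whose diagonal entries are at most `η`, the quadratic form
is, as a function of `y = v i`, of the shape `R + a y² + 2 L y` with `a = A i i` and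
`L = ∑_{j ≠ i} A i j v j`.
Put `θ = t / √(2J)`. A second-order Taylor expansion of `exp (i θ (a y² + 2 L y))` shows that
exchanging the law of `v i` for a Gaussian one costs at most a constant times
`θ² (a² + a E|L|) + |θ|³ (a³ + E|L|³)` (`norm_integral_cexp_sub_le`). As `A` is a projection,
`E L² ≤ ∑_j A i j ² = a`, and `E L⁴` is of order `a²`, so the cost is of order
`a (θ² + |θ|³) √η` for small `η`. The costs add up over `i`, with `∑_i A i i = tr A = J` and
`θ² J = t² / 2`, to a quantity that vanishes with `η` (`norm_integral_cexpQuadForm_pi_sub_le`).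

For Gaussian variables, rotation invariance turns the quadratic form into a sum of `J` independent
squares (`integral_cexpQuadForm_gaussian`), to which the classical central limit theorem applies
(`tendsto_charFun_chiSq`).

Finally `A i i ≤ CB² max |s_ij| = O_p(J / n)`, which tends to `0`. So the conditional characteristic
function is close to the Gaussian one off an event of small probability, and Fubini's theorem for
the independent pair `(v, S)` concludes (`norm_integral_sub_le_of_indepFun`).
-/

/-! ### Standardized laws -/

/-- `ρ` is a probability measure on `ℝ` with mean `0`, variance `1` and a finite sixth moment, all
of whose absolute moments of order at most `6` are bounded by `M`. -/
structure StdMoments (M : ℝ) (ρ : Measure ℝ) : Prop where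
  isProb : IsProbabilityMeasure ρ
  memLp : MemLp id 6 ρ
  mean : ∫ y, y ∂ρ = 0
  var : ∫ y, y ^ 2 ∂ρ = 1
  moment_le : ∀ k ≤ 6, ∫ y, |y| ^ k ∂ρ ≤ M

namespace StdMoments

variable {M : ℝ} {ρ : Measure ℝ}

lemma integrable_abs_pow (h : StdMoments M ρ) {k : ℕ} (hk : k ≤ 6) :
    Integrable (fun y => |y| ^ k) ρ := by
  have := h.isProb
  have h' : MemLp id (k : ℝ≥0∞) ρ := h.memLp.mono_exponent (by exact_mod_cast hk)
  simpa using h'.integrable_norm_pow'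

lemma integrable_pow (h : StdMoments M ρ) {k : ℕ} (hk : k ≤ 6) :
    Integrable (fun y : ℝ => y ^ k) ρ := by
  refine (h.integrable_abs_pow hk).mono' (by fun_prop) (ae_of_all _ fun y => ?_)
  simp

lemma integrable_id (h : StdMoments M ρ) : Integrable (fun y : ℝ => y) ρ := by
  simpa using h.integrable_pow (k := 1) (by norm_num)

lemma one_le (h : StdMoments M ρ) : 1 ≤ M := by
  have := h.isProb
  simpa using h.moment_le 0 (by norm_num)

lemma abs_moment_le (h : StdMoments M ρ) {k : ℕ} (hk : k ≤ 6) : |∫ y, y ^ k ∂ρ| ≤ M := by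
  refine (abs_integral_le_integral_abs).trans ?_
  simpa using h.moment_le k hk

end StdMoments

/-! ### Exchanging the factors of a product measure -/

section Update

variable {ι : Type*} [Fintype ι] [DecidableEq ι]

/-- Resampling one coordinate of a product measure replaces the corresponding factor. -/
theorem map_update_pi (ν : ι → Measure ℝ) [∀ i, IsProbabilityMeasure (ν i)] (i : ι)
    (ρ : Measure ℝ) [IsProbabilityMeasure ρ] :
    ((Measure.pi ν).prod ρ).map (fun p => Function.update p.1 i p.2) =
      Measure.pi (Function.update ν i ρ) := by
  have inst : ∀ j, IsProbabilityMeasure (Function.update ν i ρ j) := by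
    intro j
    by_cases hj : j = i
    · subst hj; simpa
    · rw [Function.update_of_ne hj]; infer_instance
  symm
  refine Measure.pi_eq fun s hs => ?_
  have hm : Measurable (fun p : (ι → ℝ) × ℝ => Function.update p.1 i p.2) := by
    refine measurable_pi_lambda _ fun j => ?_
    by_cases hj : j = i
    · subst hj; simpa using measurable_snd
    · simp only [Function.update_of_ne hj]; fun_prop
  rw [Measure.map_apply hm (MeasurableSet.univ_pi hs)]
  have hpre : (fun p : (ι → ℝ) × ℝ => Function.update p.1 i p.2) ⁻¹' Set.univ.pi s =
      (Set.univ.pi (Function.update s i Set.univ)) ×ˢ s i := by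
    ext p
    simp only [Set.mem_preimage, Set.mem_pi, Set.mem_univ, true_imp_iff, Set.mem_prod]
    constructor
    · intro h
      refine ⟨fun j => ?_, by simpa using h i⟩
      by_cases hj : j = i
      · subst hj; simp
      · simpa [hj] using h j
    · rintro ⟨h, h'⟩ j
      by_cases hj : j = i
      · subst hj; simpa
      · simpa [hj] using h j
  rw [hpre, Measure.prod_prod, Measure.pi_pi, ← Finset.mul_prod_erase _ _ (Finset.mem_univ i),
    ← Finset.mul_prod_erase Finset.univ (fun j => Function.update ν i ρ j (s j))
      (Finset.mem_univ i)]
  simp only [Function.update_self, measure_univ, one_mul]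
  rw [mul_comm]
  congr 1
  refine Finset.prod_congr rfl fun j hj => ?_
  simp [Finset.ne_of_mem_erase hj]

/-- Fubini's theorem in the form used for replacement: the `i`-th coordinate is integrated first,
and the `i`-th coordinate of the outer variable is a dummy. -/
theorem integral_pi_update {E : Type*} [NormedAddCommGroup E] [NormedSpace ℝ E]
    (ν : ι → Measure ℝ) [∀ i, IsProbabilityMeasure (ν i)] (i : ι)
    (ρ : Measure ℝ) [IsProbabilityMeasure ρ] {F : (ι → ℝ) → E}
    (hF : Integrable F (Measure.pi (Function.update ν i ρ))) :
    ∫ x, F x ∂(Measure.pi (Function.update ν i ρ)) =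
      ∫ x, ∫ y, F (Function.update x i y) ∂ρ ∂(Measure.pi ν) := by
  have hm : Measurable (fun p : (ι → ℝ) × ℝ => Function.update p.1 i p.2) := by
    refine measurable_pi_lambda _ fun j => ?_
    by_cases hj : j = i
    · subst hj; simpa using measurable_snd
    · simp only [Function.update_of_ne hj]; fun_prop
  rw [← map_update_pi] at hF ⊢
  rw [integral_map hm.aemeasurable hF.aestronglyMeasurable, integral_prod]
  exact hF.comp_measurable hm

theorem integral_pi_eq_integral_update {E : Type*} [NormedAddCommGroup E] [NormedSpace ℝ E]
    (ν : ι → Measure ℝ) [∀ i, IsProbabilityMeasure (ν i)] (i : ι) {F : (ι → ℝ) → E}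
    (hF : Integrable F (Measure.pi ν)) :
    ∫ x, F x ∂(Measure.pi ν) =
      ∫ x, ∫ y, F (Function.update x i y) ∂(ν i) ∂(Measure.pi ν) := by
  simpa using integral_pi_update ν i (ν i) (F := F) (by simpa using hF)

/-- Lindeberg's replacement principle: if exchanging the `i`-th factor of a product measure changes
the integral of `F` by at most `c i`, whatever the other factors are, then exchanging all factors
changes it by at most `∑ i, c i`. -/
theorem norm_integral_pi_sub_le_sum (p : Measure ℝ → Prop) (F : (ι → ℝ) → ℂ) (c : ι → ℝ)
    (h : ∀ (ν : ι → Measure ℝ), (∀ j, p (ν j)) → ∀ i ρ γ, p ρ → p γ →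
      ‖∫ x, F x ∂(Measure.pi (Function.update ν i ρ)) -
        ∫ x, F x ∂(Measure.pi (Function.update ν i γ))‖ ≤ c i)
    (ρ γ : ι → Measure ℝ) (hρ : ∀ i, p (ρ i)) (hγ : ∀ i, p (γ i)) :
    ‖∫ x, F x ∂(Measure.pi ρ) - ∫ x, F x ∂(Measure.pi γ)‖ ≤ ∑ i, c i := by
  have key : ∀ s : Finset ι,
      ‖∫ x, F x ∂(Measure.pi ρ) - ∫ x, F x ∂(Measure.pi (s.piecewise γ ρ))‖ ≤ ∑ i ∈ s, c i := by
    intro s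
    induction s using Finset.induction_on with
    | empty => simp
    | insert j s hj ih =>
      have hp : ∀ k, p (s.piecewise γ ρ k) := by
        intro k
        by_cases hk : k ∈ s
        · simpa [hk] using hγ k
        · simpa [hk] using hρ k
      have h1 := h (s.piecewise γ ρ) hp j (ρ j) (γ j) (hρ j) (hγ j)
      have h2 : Function.update (s.piecewise γ ρ) j (ρ j) = s.piecewise γ ρ := by
        rw [Function.update_eq_iff]
        simp [hj]
      rw [h2, ← Finset.piecewise_insert] at h1
      rw [Finset.sum_insert hj, add_comm]
      exact (norm_sub_le_norm_sub_add_norm_sub _ _ _).trans (add_le_add ih h1)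
  simpa using key Finset.univ

end Update

/-! ### Moments of linear forms in independent variables -/

section LinearForm

variable {ι : Type*} {M : ℝ}

lemma memLp_linearForm [Fintype ι] {ν : ι → Measure ℝ} (hν : ∀ i, StdMoments M (ν i)) (a : ι → ℝ)
    (s : Finset ι) : MemLp (fun x : ι → ℝ => ∑ j ∈ s, a j * x j) 6 (Measure.pi ν) := by
  have := fun i => (hν i).isProb
  refine memLp_finsetSum s fun j _ => MemLp.const_mul ?_ (a j)
  exact (hν j).memLp.comp_measurePreserving (measurePreserving_eval ν j)

lemma integrable_linearForm_pow [Fintype ι] {ν : ι → Measure ℝ} (hν : ∀ i, StdMoments M (ν i))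
    (a : ι → ℝ) (s : Finset ι) {k : ℕ} (hk : k ≤ 6) :
    Integrable (fun x : ι → ℝ => (∑ j ∈ s, a j * x j) ^ k) (Measure.pi ν) := by
  have := fun i => (hν i).isProb
  have h' : MemLp (fun x : ι → ℝ => ∑ j ∈ s, a j * x j) (k : ℝ≥0∞) (Measure.pi ν) :=
    (memLp_linearForm hν a s).mono_exponent (by exact_mod_cast hk)
  refine h'.integrable_norm_pow'.mono' (h'.aestronglyMeasurable.pow k) (ae_of_all _ fun x => ?_)
  simp

lemma linearForm_update [DecidableEq ι] (a : ι → ℝ) {s : Finset ι} {i : ι} (hi : i ∉ s)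
    (x : ι → ℝ) (y : ℝ) :
    ∑ j ∈ s, a j * Function.update x i y j = ∑ j ∈ s, a j * x j := by
  refine Finset.sum_congr rfl fun j hj => ?_
  rw [Function.update_of_ne]
  rintro rfl
  exact hi hj

lemma integral_linearForm [Fintype ι] {ν : ι → Measure ℝ} (hν : ∀ i, StdMoments M (ν i)) (a : ι → ℝ)
    (s : Finset ι) : ∫ x, ∑ j ∈ s, a j * x j ∂(Measure.pi ν) = 0 := by
  classical
  have := fun i => (hν i).isProb
  induction s using Finset.induction_on with
  | empty => simp
  | insert i s hi ih =>
    have hint := integrable_linearForm_pow hν a (insert i s) (k := 1) (by norm_num)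
    simp only [pow_one] at hint
    rw [integral_pi_eq_integral_update ν i hint]
    rw [← ih]
    refine integral_congr_ae (ae_of_all _ fun x => ?_)
    simp only [Finset.sum_insert hi, linearForm_update a hi, Function.update_self]
    rw [integral_add ((hν i).integrable_id.const_mul _) (integrable_const _),
      integral_const_mul, (hν i).mean]
    simp

lemma integral_linearForm_sq [Fintype ι] {ν : ι → Measure ℝ} (hν : ∀ i, StdMoments M (ν i))
    (a : ι → ℝ) (s : Finset ι) : ∫ x, (∑ j ∈ s, a j * x j) ^ 2 ∂(Measure.pi ν) = ∑ j ∈ s, a j ^ 2 := by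
  classical
  have := fun i => (hν i).isProb
  induction s using Finset.induction_on with
  | empty => simp
  | insert i s hi ih =>
    have hint := integrable_linearForm_pow hν a (insert i s) (k := 2) (by norm_num)
    rw [integral_pi_eq_integral_update ν i hint]
    have hs := integrable_linearForm_pow hν a s (k := 2) (by norm_num)
    have : ∀ x : ι → ℝ, ∫ y, (∑ j ∈ insert i s, a j * Function.update x i y j) ^ 2 ∂(ν i) =
        a i ^ 2 + (∑ j ∈ s, a j * x j) ^ 2 := by
      intro x
      simp only [Finset.sum_insert hi, linearForm_update a hi, Function.update_self]
      set L := ∑ j ∈ s, a j * x j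
      have e : ∀ y : ℝ, (a i * y + L) ^ 2 = a i ^ 2 * y ^ 2 + (2 * a i * L) * y + L ^ 2 := by
        intro y; ring
      simp_rw [e]
      have h2 := (hν i).integrable_pow (k := 2) (by norm_num)
      have h1 := (hν i).integrable_id
      rw [integral_add ((h2.const_mul _).fun_add (h1.const_mul _)) (integrable_const _),
        integral_add (h2.const_mul _) (h1.const_mul _), integral_const_mul, integral_const_mul,
        (hν i).mean, (hν i).var]
      simp
    simp_rw [this]
    rw [integral_add (integrable_const _) hs, ih, Finset.sum_insert hi]
    simp

/-- The fourth moment of a sum of independent centred variables is at most of the order of the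
squared variance. -/
lemma integral_linearForm_pow_four_le [Fintype ι] {ν : ι → Measure ℝ} (hν : ∀ i, StdMoments M (ν i))
    (a : ι → ℝ) (s : Finset ι) :
    ∫ x, (∑ j ∈ s, a j * x j) ^ 4 ∂(Measure.pi ν) ≤ 3 * M * (∑ j ∈ s, a j ^ 2) ^ 2 := by
  classical
  have := fun i => (hν i).isProb
  induction s using Finset.induction_on with
  | empty => simp
  | insert i s hi ih =>
    have hint := integrable_linearForm_pow hν a (insert i s) (k := 4) (by norm_num)
    rw [integral_pi_eq_integral_update ν i hint]
    have hs4 := integrable_linearForm_pow hν a s (k := 4) (by norm_num)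
    have hs2 := integrable_linearForm_pow hν a s (k := 2) (by norm_num)
    have hs1 := integrable_linearForm_pow hν a s (k := 1) (by norm_num)
    simp only [pow_one] at hs1
    set m3 := ∫ y, y ^ 3 ∂(ν i) with hm3
    set m4 := ∫ y, y ^ 4 ∂(ν i) with hm4
    have : ∀ x : ι → ℝ, ∫ y, (∑ j ∈ insert i s, a j * Function.update x i y j) ^ 4 ∂(ν i) =
        (∑ j ∈ s, a j * x j) ^ 4 + 6 * a i ^ 2 * (∑ j ∈ s, a j * x j) ^ 2 +
          4 * a i ^ 3 * m3 * (∑ j ∈ s, a j * x j) + a i ^ 4 * m4 := by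
      intro x
      simp only [Finset.sum_insert hi, linearForm_update a hi, Function.update_self]
      set L := ∑ j ∈ s, a j * x j
      have e : ∀ y : ℝ, (a i * y + L) ^ 4 = a i ^ 4 * y ^ 4 + (4 * a i ^ 3 * L) * y ^ 3 +
          (6 * a i ^ 2 * L ^ 2) * y ^ 2 + (4 * a i * L ^ 3) * y + L ^ 4 := by
        intro y; ring
      simp_rw [e]
      have h4 := ((hν i).integrable_pow (k := 4) (by norm_num)).const_mul (a i ^ 4)
      have h3 := ((hν i).integrable_pow (k := 3) (by norm_num)).const_mul (4 * a i ^ 3 * L)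
      have h2 := ((hν i).integrable_pow (k := 2) (by norm_num)).const_mul (6 * a i ^ 2 * L ^ 2)
      have h1 := (hν i).integrable_id.const_mul (4 * a i * L ^ 3)
      rw [integral_add (((h4.fun_add h3).fun_add h2).fun_add h1) (integrable_const _),
        integral_add ((h4.fun_add h3).fun_add h2) h1, integral_add (h4.fun_add h3) h2,
        integral_add h4 h3,
        integral_const_mul, integral_const_mul, integral_const_mul, integral_const_mul,
        (hν i).mean, (hν i).var, ← hm3, ← hm4]
      simp
      ring
    simp_rw [this]
    rw [integral_add ((hs4.fun_add (hs2.const_mul _)).fun_add (hs1.const_mul _))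
        (integrable_const _),
      integral_add (hs4.fun_add (hs2.const_mul _)) (hs1.const_mul _),
      integral_add hs4 (hs2.const_mul _), integral_const_mul, integral_const_mul,
      integral_linearForm hν, integral_linearForm_sq hν, Finset.sum_insert hi]
    have hM := (hν i).one_le
    have hm4' : m4 ≤ M := (le_abs_self _).trans ((hν i).abs_moment_le (by norm_num))
    have hσ : 0 ≤ ∑ j ∈ s, a j ^ 2 := Finset.sum_nonneg fun j _ => sq_nonneg _
    set σ := ∑ j ∈ s, a j ^ 2
    simp only [integral_const, probReal_univ, smul_eq_mul, one_mul, mul_zero, add_zero]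
    have h1 : a i ^ 4 * m4 ≤ a i ^ 4 * M := by gcongr
    have h2 : 6 * a i ^ 2 * σ ≤ 6 * a i ^ 2 * σ * M :=
      le_mul_of_one_le_right (by positivity) hM
    have h3 : 0 ≤ a i ^ 4 * M := by positivity
    nlinarith

end LinearForm

/-! ### Replacement of one variable -/

lemma norm_cexp_sub_taylor_two_le (x : ℝ) :
    ‖Complex.exp (x * Complex.I) - (1 + x * Complex.I - (x : ℂ) ^ 2 / 2)‖ ≤ 4 * |x| ^ 3 := by
  have hx : ‖(x : ℂ) * Complex.I‖ = |x| := by simp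
  rcases le_total |x| 1 with h | h
  · have := Complex.exp_bound (x := x * Complex.I) (by rw [hx]; exact h) (n := 3) (by norm_num)
    rw [hx] at this
    have e : ∑ m ∈ Finset.range 3, ((x : ℂ) * Complex.I) ^ m / (m.factorial : ℂ) =
        1 + x * Complex.I - (x : ℂ) ^ 2 / 2 := by
      simp [Finset.sum_range_succ, mul_pow, Nat.factorial]
      ring
    rw [e] at this
    refine this.trans ?_
    have : 0 ≤ |x| ^ 3 := by positivity
    norm_num [Nat.factorial]
    linarith
  · refine (norm_sub_le _ _).trans ?_
    rw [Complex.norm_exp_ofReal_mul_I]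
    have h1 : ‖1 + (x : ℂ) * Complex.I - (x : ℂ) ^ 2 / 2‖ ≤ 1 + |x| + |x| ^ 2 / 2 := by
      refine (norm_sub_le _ _).trans (add_le_add ((norm_add_le _ _).trans ?_) ?_)
      · simp
      · simp
    have h2 : |x| ≤ |x| ^ 3 := le_self_pow₀ h (by norm_num)
    have h3 : |x| ^ 2 ≤ |x| ^ 3 := pow_le_pow_right₀ h (by norm_num)
    have h4 : 1 ≤ |x| ^ 3 := one_le_pow₀ h
    linarith

/-- The effect of exchanging one standardized variable `y` for another in
`exp (i θ (a y² + 2 L y))`.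
Second-order Taylor expansion: the first-order terms agree since both laws have mean `0` and
variance `1`, and so does the leading part `4 L²` of the second-order term. -/
lemma norm_integral_cexp_sub_le {M : ℝ} {ρ γ : Measure ℝ} (hρ : StdMoments M ρ)
    (hγ : StdMoments M γ) {a : ℝ} (ha : 0 ≤ a) (L θ : ℝ) :
    ‖∫ y, Complex.exp ((θ * (a * y ^ 2 + 2 * L * y) : ℝ) * Complex.I) ∂ρ -
      ∫ y, Complex.exp ((θ * (a * y ^ 2 + 2 * L * y) : ℝ) * Complex.I) ∂γ‖ ≤
    256 * M * (θ ^ 2 * (a ^ 2 + a * |L|) + |θ| ^ 3 * (a ^ 3 + |L| ^ 3)) := by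
  set δ : ℝ → ℝ := fun y => θ * (a * y ^ 2 + 2 * L * y) with hδ
  set T : ℝ → ℂ := fun y => 1 + (δ y : ℂ) * Complex.I - (δ y : ℂ) ^ 2 / 2 with hT
  set R : ℝ → ℂ := fun y => Complex.exp ((δ y : ℝ) * Complex.I) - T y with hR
  set N : ℝ := |θ| ^ 3 * (4 * a ^ 3 * M + 32 * |L| ^ 3 * M) with hN
  have hδc : Continuous δ := by fun_prop
  have hM := hρ.one_le
  -- the second-order Taylor polynomial integrates to an explicit expression in the moments
  have key : ∀ μ : Measure ℝ, StdMoments M μ →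
      Integrable T μ ∧ Integrable R μ ∧
      ∫ y, T y ∂μ = ((1 - θ ^ 2 / 2 * (a ^ 2 * ∫ y, y ^ 4 ∂μ + 4 * a * L * ∫ y, y ^ 3 ∂μ
        + 4 * L ^ 2) : ℝ) : ℂ) + ((θ * a : ℝ) : ℂ) * Complex.I ∧
      ‖∫ y, R y ∂μ‖ ≤ 4 * N := by
    intro μ hμ
    have := hμ.isProb
    have i1 := hμ.integrable_id
    have i2 := hμ.integrable_pow (k := 2) (by norm_num)
    have i3 := hμ.integrable_pow (k := 3) (by norm_num)
    have i4 := hμ.integrable_pow (k := 4) (by norm_num)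
    have iδ : Integrable δ μ := ((i2.const_mul a).fun_add (i1.const_mul (2 * L))).const_mul θ
    have eδ : ∫ y, δ y ∂μ = θ * a := by
      simp only [hδ]
      rw [integral_const_mul, integral_add (i2.const_mul a) (i1.const_mul (2 * L)),
        integral_const_mul, integral_const_mul, hμ.mean, hμ.var]
      ring
    have eq2 : ∀ y, (δ y) ^ 2 =
        θ ^ 2 * (a ^ 2 * y ^ 4 + 4 * a * L * y ^ 3 + 4 * L ^ 2 * y ^ 2) := by
      intro y; simp only [hδ]; ring
    have iδ2 : Integrable (fun y => (δ y) ^ 2) μ := by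
      simp_rw [eq2]
      exact (((i4.const_mul _).fun_add (i3.const_mul _)).fun_add (i2.const_mul _)).const_mul _
    have eδ2 : ∫ y, (δ y) ^ 2 ∂μ =
        θ ^ 2 * (a ^ 2 * ∫ y, y ^ 4 ∂μ + 4 * a * L * ∫ y, y ^ 3 ∂μ + 4 * L ^ 2) := by
      simp_rw [eq2]
      rw [integral_const_mul, integral_add ((i4.const_mul _).fun_add (i3.const_mul _))
        (i2.const_mul _), integral_add (i4.const_mul _) (i3.const_mul _), integral_const_mul,
        integral_const_mul, integral_const_mul, hμ.var, mul_one]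
    have eT : ∀ y, T y = ((1 - δ y ^ 2 / 2 : ℝ) : ℂ) + ((δ y : ℝ) : ℂ) * Complex.I := by
      intro y; simp only [hT]; push_cast; ring
    have ir : Integrable (fun y => (1 - δ y ^ 2 / 2 : ℝ)) μ :=
      (integrable_const 1).sub (iδ2.div_const 2)
    have iT : Integrable T μ := by
      have : T = fun y => ((1 - δ y ^ 2 / 2 : ℝ) : ℂ) + ((δ y : ℝ) : ℂ) * Complex.I := funext eT
      rw [this]
      exact ir.ofReal.fun_add (iδ.ofReal.mul_const _)
    have iE : Integrable (fun y => Complex.exp ((δ y : ℝ) * Complex.I)) μ := by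
      refine (integrable_const (1 : ℝ)).mono' (Continuous.aestronglyMeasurable (by fun_prop))
        (ae_of_all _ fun y => ?_)
      rw [Complex.norm_exp_ofReal_mul_I]
    refine ⟨iT, iE.sub iT, ?_, ?_⟩
    · simp_rw [eT]
      rw [integral_add ir.ofReal (iδ.ofReal.mul_const _), integral_mul_const,
        integral_complex_ofReal, integral_complex_ofReal, eδ,
        integral_sub (integrable_const 1) (iδ2.div_const 2), integral_div, eδ2]
      simp
      ring
    · have i6 := hμ.integrable_abs_pow (k := 6) (by norm_num)
      have i3' := hμ.integrable_abs_pow (k := 3) (by norm_num)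
      have hb : ∀ y, ‖R y‖ ≤ 4 * (|θ| ^ 3 * (4 * a ^ 3 * |y| ^ 6 + 32 * |L| ^ 3 * |y| ^ 3)) := by
        intro y
        refine (norm_cexp_sub_taylor_two_le (δ y)).trans ?_
        have h1 : |δ y| ≤ |θ| * (a * |y| ^ 2 + 2 * |L| * |y|) := by
          simp only [hδ]
          rw [abs_mul]
          gcongr
          refine (abs_add_le _ _).trans ?_
          rw [abs_mul, abs_mul, abs_mul, abs_pow, abs_of_nonneg ha, abs_two]
        have h2 : (a * |y| ^ 2 + 2 * |L| * |y|) ^ 3 ≤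
            4 * ((a * |y| ^ 2) ^ 3 + (2 * |L| * |y|) ^ 3) := by
          have := add_pow_le (a := a * |y| ^ 2) (b := 2 * |L| * |y|) (by positivity)
            (by positivity) 3
          norm_num only at this
          exact this
        calc 4 * |δ y| ^ 3 ≤ 4 * (|θ| * (a * |y| ^ 2 + 2 * |L| * |y|)) ^ 3 := by gcongr
          _ = 4 * (|θ| ^ 3 * (a * |y| ^ 2 + 2 * |L| * |y|) ^ 3) := by ring
          _ ≤ 4 * (|θ| ^ 3 * (4 * ((a * |y| ^ 2) ^ 3 + (2 * |L| * |y|) ^ 3))) := by gcongr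
          _ = _ := by ring
      refine (norm_integral_le_of_norm_le ((((i6.const_mul _).fun_add
        (i3'.const_mul _)).const_mul _).const_mul _) (ae_of_all _ hb)).trans ?_
      rw [integral_const_mul, integral_const_mul, integral_add (i6.const_mul _) (i3'.const_mul _),
        integral_const_mul, integral_const_mul, hN]
      have := hμ.moment_le 6 (by norm_num)
      have := hμ.moment_le 3 (by norm_num)
      gcongr
  obtain ⟨iTρ, iRρ, eTρ, hRρ⟩ := key ρ hρ
  obtain ⟨iTγ, iRγ, eTγ, hRγ⟩ := key γ hγ
  have split : ∀ y, Complex.exp ((δ y : ℝ) * Complex.I) = T y + R y := by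
    intro y; simp [hR]
  simp only [hδ] at split
  simp_rw [split]
  rw [integral_add iTρ iRρ, integral_add iTγ iRγ, eTρ, eTγ]
  have hρ4 := abs_le.1 (hρ.abs_moment_le (k := 4) (by norm_num))
  have hρ3 := abs_le.1 (hρ.abs_moment_le (k := 3) (by norm_num))
  have hγ4 := abs_le.1 (hγ.abs_moment_le (k := 4) (by norm_num))
  have hγ3 := abs_le.1 (hγ.abs_moment_le (k := 3) (by norm_num))
  set d4 := ∫ y, y ^ 4 ∂γ - ∫ y, y ^ 4 ∂ρ with hd4
  set d3 := ∫ y, y ^ 3 ∂γ - ∫ y, y ^ 3 ∂ρ with hd3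
  have hd4' : |d4| ≤ 2 * M := by rw [abs_le]; constructor <;> linarith
  have hd3' : |d3| ≤ 2 * M := by rw [abs_le]; constructor <;> linarith
  have e : ∀ p q : ℂ, ((1 - θ ^ 2 / 2 * (a ^ 2 * ∫ y, y ^ 4 ∂ρ + 4 * a * L * ∫ y, y ^ 3 ∂ρ
        + 4 * L ^ 2) : ℝ) : ℂ) + ((θ * a : ℝ) : ℂ) * Complex.I + p -
      (((1 - θ ^ 2 / 2 * (a ^ 2 * ∫ y, y ^ 4 ∂γ + 4 * a * L * ∫ y, y ^ 3 ∂γ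
        + 4 * L ^ 2) : ℝ) : ℂ) + ((θ * a : ℝ) : ℂ) * Complex.I + q) =
      ((θ ^ 2 / 2 * (a ^ 2 * d4 + 4 * a * L * d3) : ℝ) : ℂ) + (p - q) := by
    intro p q
    simp only [hd4, hd3]
    push_cast
    ring
  rw [e]
  have h1 : ‖((θ ^ 2 / 2 * (a ^ 2 * d4 + 4 * a * L * d3) : ℝ) : ℂ)‖ ≤
      θ ^ 2 / 2 * (a ^ 2 * (2 * M) + 4 * a * |L| * (2 * M)) := by
    rw [Complex.norm_real, Real.norm_eq_abs, abs_mul, abs_of_nonneg (by positivity)]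
    gcongr
    refine (abs_add_le _ _).trans ?_
    rw [abs_mul, abs_mul, abs_mul, abs_mul, abs_of_nonneg ha, abs_of_nonneg (sq_nonneg a),
      abs_of_nonneg (by norm_num : (0 : ℝ) ≤ 4)]
    gcongr
  refine (norm_add_le _ _).trans ((add_le_add h1 ((norm_sub_le _ _).trans
    (add_le_add hRρ hRγ))).trans ?_)
  have p1 : 0 ≤ M * (θ ^ 2 * a ^ 2) := by positivity
  have p2 : 0 ≤ M * (θ ^ 2 * (a * |L|)) := by positivity
  have p3 : 0 ≤ M * (|θ| ^ 3 * a ^ 3) := by positivity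
  have p4 : 0 ≤ M * (|θ| ^ 3 * |L| ^ 3) := by positivity
  rw [hN]
  nlinarith

/-! ### Replacement in the quadratic form of a projection -/

/-- The quadratic form of a symmetric matrix, as a function of one coordinate. -/
lemma quadForm_update {n : ℕ} {A : Matrix (Fin n) (Fin n) ℝ} (hA : A.IsSymm) (x : Fin n → ℝ)
    (i : Fin n) (y : ℝ) :
    Function.update x i y ⬝ᵥ (A *ᵥ Function.update x i y) =
      Function.update x i 0 ⬝ᵥ (A *ᵥ Function.update x i 0) +
        (A i i * y ^ 2 + 2 * (∑ j ∈ Finset.univ.erase i, A i j * x j) * y) := by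
  have hu : Function.update x i y = Function.update x i 0 + y • (Pi.single i (1 : ℝ)) := by
    ext j
    by_cases hj : j = i
    · subst hj; simp
    · simp [hj]
  have hL : (A *ᵥ Function.update x i 0) i = ∑ j ∈ Finset.univ.erase i, A i j * x j := by
    rw [Matrix.mulVec, dotProduct, ← Finset.add_sum_erase _ _ (Finset.mem_univ i)]
    simp only [Function.update_self, mul_zero, zero_add]
    refine Finset.sum_congr rfl fun j hj => ?_
    rw [Function.update_of_ne (Finset.ne_of_mem_erase hj)]
  have hsw : ∀ u w : Fin n → ℝ, u ⬝ᵥ (A *ᵥ w) = w ⬝ᵥ (A *ᵥ u) := by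
    intro u w
    rw [Matrix.dotProduct_mulVec, ← Matrix.mulVec_transpose, hA.eq, dotProduct_comm]
  rw [hu]
  simp only [Matrix.mulVec_add, Matrix.mulVec_smul, dotProduct_add, add_dotProduct,
    dotProduct_smul, smul_dotProduct, smul_eq_mul]
  rw [hsw (Function.update x i 0) (Pi.single i 1), single_one_dotProduct, hL]
  simp
  ring

section Swap

variable {n : ℕ} {A : Matrix (Fin n) (Fin n) ℝ}

lemma sum_sq_row_eq (hs : A.IsSymm) (hi : IsIdempotentElem A) (i : Fin n) :
    ∑ j, A i j ^ 2 = A i i := by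
  conv_rhs => rw [← hi.eq, Matrix.mul_apply]
  refine Finset.sum_congr rfl fun j _ => ?_
  rw [hs.apply i j, sq]

lemma diag_nonneg (hs : A.IsSymm) (hi : IsIdempotentElem A) (i : Fin n) : 0 ≤ A i i := by
  rw [← sum_sq_row_eq hs hi]
  exact Finset.sum_nonneg fun j _ => sq_nonneg _

lemma sum_sq_row_erase_le (hs : A.IsSymm) (hi : IsIdempotentElem A) (i : Fin n) :
    ∑ j ∈ Finset.univ.erase i, A i j ^ 2 ≤ A i i := by
  rw [← sum_sq_row_eq hs hi]
  exact Finset.sum_le_sum_of_subset_of_nonneg (Finset.subset_univ _) fun j _ _ => sq_nonneg _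

lemma continuous_quadForm (A : Matrix (Fin n) (Fin n) ℝ) :
    Continuous fun x : Fin n → ℝ => x ⬝ᵥ (A *ᵥ x) := by
  simp only [dotProduct, Matrix.mulVec]
  fun_prop

/-- The integrand `exp (i θ x'Ax)` of the characteristic function, at `θ`, of the quadratic form
with matrix `A`. -/
noncomputable def cexpQuadForm (A : Matrix (Fin n) (Fin n) ℝ) (θ : ℝ) (x : Fin n → ℝ) : ℂ :=
  Complex.exp ((θ * (x ⬝ᵥ (A *ᵥ x)) : ℝ) * Complex.I)

lemma continuous_cexpQuadForm (A : Matrix (Fin n) (Fin n) ℝ) (θ : ℝ) :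
    Continuous (cexpQuadForm A θ) := by
  have := continuous_quadForm A
  unfold cexpQuadForm
  fun_prop

lemma integrable_cexpQuadForm (A : Matrix (Fin n) (Fin n) ℝ) (θ : ℝ) (μ : Measure (Fin n → ℝ))
    [IsFiniteMeasure μ] : Integrable (cexpQuadForm A θ) μ := by
  refine (integrable_const (1 : ℝ)).mono' (continuous_cexpQuadForm A θ).aestronglyMeasurable
    (ae_of_all _ fun y => ?_)
  rw [cexpQuadForm, Complex.norm_exp_ofReal_mul_I]

/-- One step of the replacement. The bound is proportional to the diagonal entry, so that summation
over the coordinates produces the trace. -/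
lemma norm_integral_cexpQuadForm_update_sub_le {M η : ℝ} (hs : A.IsSymm)
    (hi : IsIdempotentElem A) (hη : 0 < η) (hAη : ∀ i, A i i ≤ η) (θ : ℝ)
    {ν : Fin n → Measure ℝ} (hν : ∀ i, StdMoments M (ν i)) (i : Fin n) {ρ γ : Measure ℝ}
    (hρ : StdMoments M ρ) (hγ : StdMoments M γ) :
    ‖∫ x, cexpQuadForm A θ x ∂(Measure.pi (Function.update ν i ρ)) -
      ∫ x, cexpQuadForm A θ x ∂(Measure.pi (Function.update ν i γ))‖ ≤
    512 * M ^ 2 * (θ ^ 2 * (η + √η) + |θ| ^ 3 * (η ^ 2 + √η)) * A i i := by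
  have := fun i => (hν i).isProb
  have := hρ.isProb
  have := hγ.isProb
  have hM := hρ.one_le
  have inst : ∀ (τ : Measure ℝ), IsProbabilityMeasure τ →
      ∀ j, IsProbabilityMeasure (Function.update ν i τ j) := by
    intro τ hτ j
    by_cases hj : j = i
    · subst hj; simpa
    · rw [Function.update_of_ne hj]; infer_instance
  have := inst ρ inferInstance
  have := inst γ inferInstance
  rw [integral_pi_update ν i ρ (integrable_cexpQuadForm A θ _),
    integral_pi_update ν i γ (integrable_cexpQuadForm A θ _)]
  set L : (Fin n → ℝ) → ℝ := fun x => ∑ j ∈ Finset.univ.erase i, A i j * x j with hL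
  set a := A i i with ha
  have ha0 : 0 ≤ a := diag_nonneg hs hi i
  have haη : a ≤ η := hAη i
  set r := √η with hr
  have hr0 : 0 < r := Real.sqrt_pos.2 hη
  have hr2 : r ^ 2 = η := Real.sq_sqrt hη.le
  have hfac : ∀ x y, cexpQuadForm A θ (Function.update x i y) =
      cexpQuadForm A θ (Function.update x i 0) *
        Complex.exp ((θ * (a * y ^ 2 + 2 * L x * y) : ℝ) * Complex.I) := by
    intro x y
    rw [cexpQuadForm, cexpQuadForm, quadForm_update hs, ← Complex.exp_add, ← add_mul,
      ← Complex.ofReal_add, ← mul_add]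
  have hint : ∀ τ : Measure ℝ, IsProbabilityMeasure τ →
      Integrable (fun x => ∫ y, cexpQuadForm A θ (Function.update x i y) ∂τ) (Measure.pi ν) := by
    intro τ hτ
    have hc : Continuous (fun p : (Fin n → ℝ) × ℝ =>
        cexpQuadForm A θ (Function.update p.1 i p.2)) :=
      (continuous_cexpQuadForm A θ).comp (by fun_prop)
    have : Integrable (fun p : (Fin n → ℝ) × ℝ =>
        cexpQuadForm A θ (Function.update p.1 i p.2)) ((Measure.pi ν).prod τ) := by
      refine (integrable_const (1 : ℝ)).mono' hc.aestronglyMeasurable (ae_of_all _ fun y => ?_)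
      rw [cexpQuadForm, Complex.norm_exp_ofReal_mul_I]
    exact this.integral_prod_left
  rw [← integral_sub (hint ρ inferInstance) (hint γ inferInstance)]
  have hL2 := integrable_linearForm_pow hν (A i) (Finset.univ.erase i) (k := 2) (by norm_num)
  have hL4 := integrable_linearForm_pow hν (A i) (Finset.univ.erase i) (k := 4) (by norm_num)
  have eL2 := integral_linearForm_sq hν (A i) (Finset.univ.erase i)
  have eL4 := integral_linearForm_pow_four_le hν (A i) (Finset.univ.erase i)
  have hσ := sum_sq_row_erase_le hs hi i
  have hσ0 : 0 ≤ ∑ j ∈ Finset.univ.erase i, A i j ^ 2 :=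
    Finset.sum_nonneg fun j _ => sq_nonneg _
  set σ := ∑ j ∈ Finset.univ.erase i, A i j ^ 2
  -- odd moments of `L` are controlled by even ones, at the scale `√η` of `L`
  have hpt : ∀ x, ‖∫ y, cexpQuadForm A θ (Function.update x i y) ∂ρ -
      ∫ y, cexpQuadForm A θ (Function.update x i y) ∂γ‖ ≤
      256 * M * (θ ^ 2 * (a ^ 2 + a * ((r + r⁻¹ * L x ^ 2) / 2)) +
        |θ| ^ 3 * (a ^ 3 + (r * L x ^ 2 + r⁻¹ * L x ^ 4) / 2)) := by
    intro x
    rw [integral_congr_ae (ae_of_all ρ (hfac x)), integral_congr_ae (ae_of_all γ (hfac x)),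
      integral_const_mul, integral_const_mul, ← mul_sub, norm_mul, cexpQuadForm,
      Complex.norm_exp_ofReal_mul_I, one_mul]
    refine (norm_integral_cexp_sub_le hρ hγ ha0 (L x) θ).trans ?_
    have h1 : |L x| ≤ (r + r⁻¹ * L x ^ 2) / 2 := by
      have h : 0 ≤ r⁻¹ * (r - |L x|) ^ 2 := mul_nonneg (inv_nonneg.2 hr0.le) (sq_nonneg _)
      have e : r⁻¹ * (r - |L x|) ^ 2 = r - 2 * |L x| + r⁻¹ * |L x| ^ 2 := by
        linear_combination (r - 2 * |L x|) * inv_mul_cancel₀ hr0.ne'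
      rw [e, sq_abs] at h
      linarith
    have h3 : |L x| ^ 3 ≤ (r * L x ^ 2 + r⁻¹ * L x ^ 4) / 2 := by
      calc |L x| ^ 3 = |L x| ^ 2 * |L x| := by ring
        _ ≤ |L x| ^ 2 * ((r + r⁻¹ * L x ^ 2) / 2) := by gcongr
        _ = _ := by rw [sq_abs]; ring
    gcongr
  have iB : Integrable (fun x => 256 * M * (θ ^ 2 * (a ^ 2 + a * ((r + r⁻¹ * L x ^ 2) / 2)) +
        |θ| ^ 3 * (a ^ 3 + (r * L x ^ 2 + r⁻¹ * L x ^ 4) / 2))) (Measure.pi ν) := by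
    refine Integrable.const_mul (Integrable.add (Integrable.const_mul (Integrable.add
      (integrable_const _) (Integrable.const_mul (Integrable.div_const (Integrable.add
      (integrable_const _) (hL2.const_mul _)) _) _)) _) (Integrable.const_mul (Integrable.add
      (integrable_const _) (Integrable.div_const (Integrable.add (hL2.const_mul _)
      (hL4.const_mul _)) _)) _)) _
  refine (norm_integral_le_of_norm_le iB (ae_of_all _ hpt)).trans ?_
  have eB : ∀ x, 256 * M * (θ ^ 2 * (a ^ 2 + a * ((r + r⁻¹ * L x ^ 2) / 2)) +
        |θ| ^ 3 * (a ^ 3 + (r * L x ^ 2 + r⁻¹ * L x ^ 4) / 2)) =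
      256 * M * (θ ^ 2 * (a ^ 2 + a * r / 2) + |θ| ^ 3 * a ^ 3) +
      256 * M * (θ ^ 2 * (a * r⁻¹ / 2) + |θ| ^ 3 * (r / 2)) * L x ^ 2 +
      256 * M * (|θ| ^ 3 * (r⁻¹ / 2)) * L x ^ 4 := by
    intro x; ring
  simp_rw [eB]
  rw [integral_add ((integrable_const _).fun_add (hL2.const_mul _)) (hL4.const_mul _),
    integral_add (integrable_const _) (hL2.const_mul _), integral_const, integral_const_mul,
    integral_const_mul, eL2]
  simp only [probReal_univ, smul_eq_mul, one_mul]
  have hra : r⁻¹ * a ≤ r := by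
    rw [inv_mul_le_iff₀ hr0, ← sq, hr2]; exact haη
  have b4 : ∫ x, L x ^ 4 ∂(Measure.pi ν) ≤ 3 * M * a ^ 2 := eL4.trans (by gcongr)
  calc _ ≤ 256 * M * (θ ^ 2 * (a ^ 2 + a * r / 2) + |θ| ^ 3 * a ^ 3) +
      256 * M * (θ ^ 2 * (a * r⁻¹ / 2) + |θ| ^ 3 * (r / 2)) * a +
      256 * M * (|θ| ^ 3 * (r⁻¹ / 2)) * (3 * M * a ^ 2) := by
        refine add_le_add (add_le_add le_rfl ?_) (mul_le_mul_of_nonneg_left b4 (by positivity))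
        gcongr
    _ = 256 * M * (θ ^ 2 * (a + r / 2 + (r⁻¹ * a) / 2) +
          |θ| ^ 3 * (a ^ 2 + r / 2 + 3 / 2 * M * (r⁻¹ * a))) * a := by ring
    _ ≤ 256 * M * (θ ^ 2 * (η + r / 2 + r / 2) +
          |θ| ^ 3 * (η ^ 2 + r / 2 + 3 / 2 * M * r)) * a := by gcongr
    _ ≤ 256 * M * (θ ^ 2 * ((2 * M) * (η + r)) + |θ| ^ 3 * ((2 * M) * (η ^ 2 + r))) * a := by
        have h1 : η + r / 2 + r / 2 ≤ (2 * M) * (η + r) := by nlinarith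
        have h2 : η ^ 2 + r / 2 + 3 / 2 * M * r ≤ (2 * M) * (η ^ 2 + r) := by
          nlinarith [sq_nonneg η, mul_le_mul_of_nonneg_right hM hr0.le,
            mul_le_mul_of_nonneg_right hM (sq_nonneg η)]
        gcongr
    _ = _ := by ring

/-- Universality: up to a small error, the characteristic function of the quadratic form of a
projection with small diagonal does not depend on the laws of the coordinates. -/
theorem norm_integral_cexpQuadForm_pi_sub_le {M η : ℝ} (hs : A.IsSymm)
    (hi : IsIdempotentElem A) (hη : 0 < η) (hAη : ∀ i, A i i ≤ η) (θ : ℝ)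
    {ρ γ : Fin n → Measure ℝ} (hρ : ∀ i, StdMoments M (ρ i)) (hγ : ∀ i, StdMoments M (γ i)) :
    ‖∫ x, cexpQuadForm A θ x ∂(Measure.pi ρ) - ∫ x, cexpQuadForm A θ x ∂(Measure.pi γ)‖ ≤
    512 * M ^ 2 * (θ ^ 2 * (η + √η) + |θ| ^ 3 * (η ^ 2 + √η)) * A.trace := by
  refine (norm_integral_pi_sub_le_sum (StdMoments M) (cexpQuadForm A θ) _ ?_ ρ γ hρ hγ).trans
    (le_of_eq (Finset.mul_sum _ _ _).symm)
  intro ν hν i ρ γ hρ hγ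
  exact norm_integral_cexpQuadForm_update_sub_le hs hi hη hAη θ hν i hρ hγ

end Swap

/-! ### Moments of the standard Gaussian law -/

lemma integral_sq_gaussianReal : ∫ y, y ^ 2 ∂(gaussianReal 0 1) = 1 := by
  have h := variance_fun_id_gaussianReal (μ := 0) (v := 1)
  rw [variance_eq_integral measurable_id'.aemeasurable] at h
  simpa using h

/-- The fourth derivative at `0` of the moment generating function `exp (t² / 2)`. -/
lemma integral_pow_four_gaussianReal : ∫ y, y ^ 4 ∂(gaussianReal 0 1) = 3 := by
  have h : iteratedDeriv 4 (mgf (fun x ↦ x) (gaussianReal 0 1)) 0 =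
      ∫ y, y ^ 4 ∂(gaussianReal 0 1) := by
    rw [iteratedDeriv_mgf_zero] <;> simp
  rw [← h, mgf_fun_id_gaussianReal]
  -- `(p exp (t² / 2))' = (p' + p t) exp (t² / 2)`
  have step : ∀ (p q : ℝ → ℝ), (∀ t, HasDerivAt p (q t) t) →
      deriv (fun t => p t * Real.exp (t ^ 2 / 2)) =
        fun t => (q t + p t * t) * Real.exp (t ^ 2 / 2) := by
    intro p q hp
    ext t
    have he : HasDerivAt (fun t : ℝ => Real.exp (t ^ 2 / 2)) (Real.exp (t ^ 2 / 2) * t) t := by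
      have : HasDerivAt (fun t : ℝ => t ^ 2 / 2) t t := by
        simpa using (hasDerivAt_pow 2 t).div_const 2
      exact this.exp
    refine ((hp t).fun_mul he).deriv.trans ?_
    ring
  have e0 : (fun t : ℝ => Real.exp (0 * t + ((1 : ℝ≥0) : ℝ) * t ^ 2 / 2)) =
      fun t => 1 * Real.exp (t ^ 2 / 2) := by
    ext t; simp
  have e1 := step (fun _ => 1) (fun _ => 0) (fun t => hasDerivAt_const t _)
  have e2 := step (fun t => 0 + 1 * t) (fun _ => 1) (fun t => by
    simpa using hasDerivAt_id' t)
  have e3 := step (fun t => 1 + (0 + 1 * t) * t) (fun t => 2 * t) (fun t => by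
    have := (hasDerivAt_pow 2 t).const_add 1
    simpa [sq] using this)
  have e4 := step (fun t => 2 * t + (1 + (0 + 1 * t) * t) * t) (fun t => 3 + 3 * t ^ 2) (fun t => by
    have := ((hasDerivAt_id' t).const_mul 3).add (hasDerivAt_pow 3 t)
    refine (this.congr_deriv ?_).congr_of_eventuallyEq (Eventually.of_forall fun u => ?_)
    · simp
    · simp; ring)
  simp only [iteratedDeriv_succ, iteratedDeriv_zero]
  rw [e0, e1, e2, e3, e4]
  norm_num

lemma integrable_pow_gaussianReal (k : ℕ) : Integrable (fun y : ℝ => y ^ k) (gaussianReal 0 1) := by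
  refine (memLp_id_gaussianReal (μ := 0) (v := 1) k).integrable_norm_pow'.mono' (by fun_prop)
    (ae_of_all _ fun y => ?_)
  simp

lemma exists_stdMoments_gaussianReal : ∃ M, StdMoments M (gaussianReal 0 1) := by
  refine ⟨∑ k ∈ Finset.range 7, ∫ y, |y| ^ k ∂(gaussianReal 0 1), inferInstance,
    memLp_id_gaussianReal 6, integral_id_gaussianReal, integral_sq_gaussianReal, fun k hk => ?_⟩
  exact Finset.single_le_sum (f := fun k => ∫ y, |y| ^ k ∂(gaussianReal 0 1))
    (fun j _ => integral_nonneg fun y => by positivity) (Finset.mem_range.2 (by omega))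

lemma StdMoments.mono {M M' : ℝ} {ρ : Measure ℝ} (h : StdMoments M ρ) (hM : M ≤ M') :
    StdMoments M' ρ :=
  ⟨h.isProb, h.memLp, h.mean, h.var, fun k hk => (h.moment_le k hk).trans hM⟩

/-! ### Quadratic forms in Gaussian variables -/

section Gaussian

variable {n : ℕ} {A : Matrix (Fin n) (Fin n) ℝ}

lemma eigenvalues_eq_zero_or_one (hA : A.IsHermitian) (hi : IsIdempotentElem A) (i : Fin n) :
    hA.eigenvalues i = 0 ∨ hA.eigenvalues i = 1 := by
  have h := hi.spectrum_subset ℝ (hA.eigenvalues_mem_spectrum_real i)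
  simpa using h

lemma trace_eq_rank_of_isIdempotentElem (hA : A.IsHermitian) (hi : IsIdempotentElem A) :
    A.trace = A.rank := by
  classical
  rw [hA.trace_eq_sum_eigenvalues, hA.rank_eq_card_non_zero_eigs, Fintype.card_subtype,
    Finset.card_filter]
  push_cast
  refine Finset.sum_congr rfl fun i _ => ?_
  rcases eigenvalues_eq_zero_or_one hA hi i with h | h <;> simp [h]

/-- By rotation invariance, the quadratic form of a projection of rank `r` in independent standard
Gaussian variables is a sum of `r` independent squared standard Gaussian variables. -/
theorem integral_cexpQuadForm_gaussian (hs : A.IsSymm) (hi : IsIdempotentElem A) (θ : ℝ) :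
    ∫ x, cexpQuadForm A θ x ∂(Measure.pi fun _ : Fin n => gaussianReal 0 1) =
      (∫ y, Complex.exp ((θ * y ^ 2 : ℝ) * Complex.I) ∂(gaussianReal 0 1)) ^ A.rank := by
  have hA : A.IsHermitian := by
    rw [Matrix.IsHermitian, Matrix.conjTranspose_eq_transpose_of_trivial]; exact hs
  set b := hA.eigenvectorBasis with hb
  have hmeas : AEMeasurable (fun x : Fin n → ℝ => ∑ i, x i • b i)
      (Measure.pi fun _ : Fin n => gaussianReal 0 1) :=
    Measurable.aemeasurable (by fun_prop)
  have hmap := (map_pi_eq_stdGaussian (ι := Fin n)).trans (stdGaussian_eq_map_pi_orthonormalBasis b)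
  have hc : Continuous fun x : EuclideanSpace ℝ (Fin n) => cexpQuadForm A θ x.ofLp :=
    (continuous_cexpQuadForm A θ).comp (by fun_prop)
  have h1 : ∫ x, cexpQuadForm A θ x ∂(Measure.pi fun _ : Fin n => gaussianReal 0 1) =
      ∫ x, cexpQuadForm A θ (∑ i, x i • b i : EuclideanSpace ℝ (Fin n)).ofLp
        ∂(Measure.pi fun _ : Fin n => gaussianReal 0 1) := by
    rw [← integral_map (f := fun x : EuclideanSpace ℝ (Fin n) => cexpQuadForm A θ x.ofLp) hmeas
      hc.aestronglyMeasurable, ← hmap, integral_map (by fun_prop) hc.aestronglyMeasurable]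
  have hQ : ∀ x : Fin n → ℝ, (∑ i, x i • b i : EuclideanSpace ℝ (Fin n)).ofLp ⬝ᵥ
      (A *ᵥ (∑ i, x i • b i : EuclideanSpace ℝ (Fin n)).ofLp) =
      ∑ i, hA.eigenvalues i * x i ^ 2 := by
    intro x
    have e : A *ᵥ (∑ i, x i • b i : EuclideanSpace ℝ (Fin n)).ofLp =
        (∑ i, (x i * hA.eigenvalues i) • b i : EuclideanSpace ℝ (Fin n)).ofLp := by
      simp only [WithLp.ofLp_sum, WithLp.ofLp_smul, Matrix.mulVec_sum, Matrix.mulVec_smul]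
      refine Finset.sum_congr rfl fun i _ => ?_
      rw [hA.mulVec_eigenvectorBasis, smul_smul]
    rw [e, dotProduct_comm]
    have : ∀ u w : EuclideanSpace ℝ (Fin n), w.ofLp ⬝ᵥ u.ofLp = inner ℝ u w := by
      intro u w
      simp [EuclideanSpace.inner_eq_star_dotProduct]
    rw [this, b.orthonormal.inner_sum]
    refine Finset.sum_congr rfl fun i _ => ?_
    simp
    ring
  rw [h1]
  have h2 : ∀ x : Fin n → ℝ, cexpQuadForm A θ (∑ i, x i • b i : EuclideanSpace ℝ (Fin n)).ofLp =
      ∏ i, Complex.exp ((θ * (hA.eigenvalues i * x i ^ 2) : ℝ) * Complex.I) := by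
    intro x
    rw [cexpQuadForm, hQ, ← Complex.exp_sum]
    congr 1
    push_cast
    rw [Finset.mul_sum, Finset.sum_mul]
  simp_rw [h2]
  rw [integral_fintype_prod_eq_prod
    (f := fun i (y : ℝ) => Complex.exp ((θ * (hA.eigenvalues i * y ^ 2) : ℝ) * Complex.I)),
    hA.rank_eq_card_non_zero_eigs, Fintype.card_subtype, ← Finset.prod_const, Finset.prod_filter]
  refine Finset.prod_congr rfl fun i _ => ?_
  rcases eigenvalues_eq_zero_or_one hA hi i with h | h <;> simp [h]

end Gaussian

/-- The central limit theorem for standardized chi-square variables, in terms of characteristic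
functions. -/
theorem tendsto_charFun_chiSq (t : ℝ) :
    Tendsto (fun J : ℕ => Complex.exp ((-(t / √(2 * J) * J) : ℝ) * Complex.I) *
      (∫ y, Complex.exp ((t / √(2 * J) * y ^ 2 : ℝ) * Complex.I) ∂(gaussianReal 0 1)) ^ J)
      atTop (𝓝 (Complex.exp (-(t : ℂ) ^ 2 / 2))) := by
  have h2 := integrable_pow_gaussianReal 2
  have h4 := integrable_pow_gaussianReal 4
  have h := tendsto_charFun_inv_sqrt_mul_pow (P := gaussianReal 0 1)
    (X := fun y => (y ^ 2 - 1) / √2) (by fun_prop) ?_ ?_ t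
  · refine h.congr fun J => ?_
    have e : charFun ((gaussianReal 0 1).map fun y => (y ^ 2 - 1) / √2) ((√J)⁻¹ * t) =
        Complex.exp ((-(t / √(2 * J)) : ℝ) * Complex.I) *
        ∫ y, Complex.exp ((t / √(2 * J) * y ^ 2 : ℝ) * Complex.I) ∂(gaussianReal 0 1) := by
      rw [charFun_apply_real, integral_map (by fun_prop)
        (Continuous.aestronglyMeasurable (by fun_prop)), ← integral_const_mul]
      refine integral_congr_ae (ae_of_all _ fun y => ?_)
      simp only
      rw [← Complex.exp_add, ← add_mul, ← Complex.ofReal_add, ← Complex.ofReal_mul]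
      congr 3
      rw [Real.sqrt_mul (by norm_num)]
      simp only [div_eq_mul_inv, mul_inv]
      ring
    rw [e, mul_pow, ← Complex.exp_nat_mul]
    congr 2
    push_cast
    ring
  · rw [integral_div, integral_sub h2 (integrable_const _), integral_sq_gaussianReal]
    simp
  · have e : ∀ y : ℝ, ((fun y : ℝ => (y ^ 2 - 1) / √2) ^ 2) y = (y ^ 4 - 2 * y ^ 2 + 1) / 2 := by
      intro y
      simp only [Pi.pow_apply, div_pow]
      rw [Real.sq_sqrt (by norm_num)]
      ring
    have h42 : Integrable (fun y : ℝ => y ^ 4 - 2 * y ^ 2) (gaussianReal 0 1) :=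
      h4.sub (h2.const_mul 2)
    simp_rw [e]
    rw [integral_div, integral_add h42 (integrable_const _),
      integral_sub h4 (h2.const_mul 2), integral_const_mul, integral_sq_gaussianReal,
      integral_pow_four_gaussianReal]
    norm_num

/-! ### Conditional estimate and randomization -/

/-- Diagonal entries of `B'SB` inherit the size of the entries of `S` when `B` has
bounded absolute column sums. -/
lemma diag_conj_le {n : ℕ} {B S : Matrix (Fin n) (Fin n) ℝ} {CB m : ℝ}
    (hB : ∀ j, ∑ i, |B i j| ≤ CB) (hS : ∀ i j, |S i j| ≤ m) (i : Fin n) :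
    (Bᵀ * S * B) i i ≤ CB ^ 2 * m := by
  have hm : 0 ≤ m := (abs_nonneg _).trans (hS i i)
  have hCB : 0 ≤ CB := (Finset.sum_nonneg fun _ _ => abs_nonneg _).trans (hB i)
  rw [Matrix.mul_apply]
  have h1 : ∀ l, (Bᵀ * S) i l * B l i ≤ CB * m * |B l i| := by
    intro l
    refine (le_abs_self _).trans ?_
    rw [abs_mul, Matrix.mul_apply]
    gcongr
    refine (Finset.abs_sum_le_sum_abs _ _).trans ?_
    calc ∑ k, |Bᵀ i k * S k l| ≤ ∑ k, |B k i| * m := by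
          refine Finset.sum_le_sum fun k _ => ?_
          rw [abs_mul, Matrix.transpose_apply]
          gcongr
          exact hS k l
      _ = (∑ k, |B k i|) * m := by rw [Finset.sum_mul]
      _ ≤ CB * m := by gcongr; exact hB i
  calc ∑ l, (Bᵀ * S) i l * B l i ≤ ∑ l, CB * m * |B l i| := Finset.sum_le_sum fun l _ => h1 l
    _ = CB * m * ∑ l, |B l i| := by rw [Finset.mul_sum]
    _ ≤ CB * m * CB := by gcongr; exact hB i
    _ = _ := by ring

lemma stdMoments_map {Ω : Type*} [MeasurableSpace Ω] {P : Measure Ω} [IsProbabilityMeasure P]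
    {X : Ω → ℝ} (hX : AEMeasurable X P) (h0 : ∫ ω, X ω ∂P = 0) (h1 : variance X P = 1)
    {s : ℝ} (hs : 6 ≤ s) {C : ℝ≥0} (hC : ∫⁻ ω, ‖X ω‖ₑ ^ s ∂P ≤ C) :
    StdMoments (1 + C) (P.map X) := by
  have hs0 : 0 < s := by linarith
  have hLs : MemLp X (ENNReal.ofReal s) P := by
    refine ⟨hX.aestronglyMeasurable, ?_⟩
    rw [eLpNorm_lt_top_iff_lintegral_rpow_enorm_lt_top (by simpa using hs0) (by simp),
      ENNReal.toReal_ofReal hs0.le]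
    exact hC.trans_lt (by simp)
  have hL6 : MemLp X 6 P := hLs.mono_exponent (by
    rw [← ENNReal.ofReal_ofNat]; exact ENNReal.ofReal_le_ofReal hs)
  refine ⟨Measure.isProbabilityMeasure_map hX, ?_, ?_, ?_, fun k hk => ?_⟩
  · rw [memLp_map_measure_iff (by fun_prop) hX]
    exact hL6
  · rw [integral_map hX (by fun_prop)]
    exact h0
  · rw [integral_map hX (by fun_prop)]
    rw [variance_eq_integral hX] at h1
    simpa [h0] using h1
  · rw [integral_map hX (by fun_prop)]
    have hle : ∫⁻ ω, ENNReal.ofReal (|X ω| ^ k) ∂P ≤ ENNReal.ofReal (1 + C) := by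
      calc ∫⁻ ω, ENNReal.ofReal (|X ω| ^ k) ∂P ≤ ∫⁻ ω, (1 + ‖X ω‖ₑ ^ s) ∂P := by
            refine lintegral_mono fun ω => ?_
            rw [ENNReal.ofReal_pow (abs_nonneg _), ← Real.enorm_eq_ofReal_abs]
            rcases le_total ‖X ω‖ₑ 1 with h | h
            · exact (pow_le_one₀ zero_le h).trans le_self_add
            · rw [← ENNReal.rpow_natCast]
              refine (ENNReal.rpow_le_rpow_of_exponent_le h ?_).trans le_add_self
              have : (k : ℝ) ≤ 6 := by exact_mod_cast hk
              linarith
        _ = 1 + ∫⁻ ω, ‖X ω‖ₑ ^ s ∂P := by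
            rw [lintegral_add_left measurable_const]; simp
        _ ≤ 1 + C := by gcongr
        _ = _ := by
            rw [ENNReal.ofReal_add (by norm_num) C.coe_nonneg]; simp
    rw [integral_eq_lintegral_of_nonneg_ae (ae_of_all _ fun ω => by positivity)
      (by fun_prop)]
    exact ENNReal.toReal_le_of_le_ofReal (by positivity) hle

/-- Quantitative central limit theorem for the quadratic form of a fixed projection. The second
summand of the bound is the error for standardized chi-square variables. -/
theorem norm_integral_standardized_sub_le {n : ℕ} {A : Matrix (Fin n) (Fin n) ℝ} {M η : ℝ}
    (hs : A.IsSymm) (hi : IsIdempotentElem A) (hη : 0 < η) (hAη : ∀ i, A i i ≤ η) {J : ℕ}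
    (hJ : A.rank = J) (hJ1 : 1 ≤ J) (t : ℝ) {ρ : Fin n → Measure ℝ}
    (hρ : ∀ i, StdMoments M (ρ i)) (hγ : StdMoments M (gaussianReal 0 1)) :
    ‖Complex.exp ((-(t / √(2 * J) * J) : ℝ) * Complex.I) *
        ∫ x, cexpQuadForm A (t / √(2 * J)) x ∂(Measure.pi ρ) - Complex.exp (-(t : ℂ) ^ 2 / 2)‖ ≤
      512 * M ^ 2 * (t ^ 2 / 2 * (η + √η) + |t| * (t ^ 2 / 2) * (η ^ 2 + √η)) +
      ‖Complex.exp ((-(t / √(2 * J) * J) : ℝ) * Complex.I) *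
        (∫ y, Complex.exp ((t / √(2 * J) * y ^ 2 : ℝ) * Complex.I) ∂(gaussianReal 0 1)) ^ J -
        Complex.exp (-(t : ℂ) ^ 2 / 2)‖ := by
  have hA : A.IsHermitian := by
    rw [Matrix.IsHermitian, Matrix.conjTranspose_eq_transpose_of_trivial]; exact hs
  have hJ' : (1 : ℝ) ≤ J := by exact_mod_cast hJ1
  have key := norm_integral_cexpQuadForm_pi_sub_le hs hi hη hAη (t / √(2 * J)) hρ (fun _ => hγ)
  rw [integral_cexpQuadForm_gaussian hs hi, trace_eq_rank_of_isIdempotentElem hA hi, hJ] at key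
  set θ := t / √(2 * J) with hθ
  have hθ2 : θ ^ 2 * J = t ^ 2 / 2 := by
    rw [hθ, div_pow, Real.sq_sqrt (by positivity)]
    field_simp
  have hθ1 : |θ| ≤ |t| := by
    rw [hθ, abs_div, abs_of_nonneg (Real.sqrt_nonneg _)]
    refine div_le_self (abs_nonneg _) ?_
    rw [Real.one_le_sqrt]
    linarith
  refine (norm_sub_le_norm_sub_add_norm_sub _ (Complex.exp ((-(θ * J) : ℝ) * Complex.I) *
    (∫ y, Complex.exp ((θ * y ^ 2 : ℝ) * Complex.I) ∂(gaussianReal 0 1)) ^ J) _).trans ?_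
  gcongr
  rw [← mul_sub, norm_mul, Complex.norm_exp_ofReal_mul_I, one_mul]
  refine key.trans ?_
  calc 512 * M ^ 2 * (θ ^ 2 * (η + √η) + |θ| ^ 3 * (η ^ 2 + √η)) * J =
      512 * M ^ 2 * (θ ^ 2 * J * (η + √η) + |θ| * (|θ| ^ 2 * J) * (η ^ 2 + √η)) := by ring
    _ ≤ _ := by
      rw [sq_abs, hθ2]
      gcongr

/-- Conditioning on an independent component: if the conditional expectation `G` of a function of
the pair `(V, W)` is within `e` of `c` off a set `D`, and within `2` of `c` everywhere, then the
expectation is within `e + 2 P(D)` of `c`. -/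
lemma norm_integral_sub_le_of_indepFun {Ω 𝓧 𝓨 : Type*} [MeasurableSpace Ω] [MeasurableSpace 𝓧]
    [MeasurableSpace 𝓨] {P : Measure Ω} [IsProbabilityMeasure P] {V : Ω → 𝓧} {W : Ω → 𝓨}
    (hV : AEMeasurable V P) (hW : AEMeasurable W P) (hVW : IndepFun V W P)
    {F : 𝓧 × 𝓨 → ℂ} (hF : StronglyMeasurable F) (hF1 : ∀ p, ‖F p‖ ≤ 1) {c : ℂ} (hc : ‖c‖ ≤ 1)
    {D : Set Ω} {e : ℝ} (he : 0 ≤ e)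
    (h : ∀ᵐ ω ∂P, ω ∉ D → ‖∫ x, F (x, W ω) ∂(P.map V) - c‖ ≤ e) :
    ‖∫ ω, F (V ω, W ω) ∂P - c‖ ≤ e + 2 * (P D).toReal := by
  have : IsProbabilityMeasure (P.map V) := Measure.isProbabilityMeasure_map hV
  have : IsProbabilityMeasure (P.map W) := Measure.isProbabilityMeasure_map hW
  have hFint : Integrable F ((P.map V).prod (P.map W)) :=
    (integrable_const (1 : ℝ)).mono' hF.aestronglyMeasurable (ae_of_all _ hF1)
  have e1 : ∫ ω, F (V ω, W ω) ∂P = ∫ ω, ∫ x, F (x, W ω) ∂(P.map V) ∂P := by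
    have hG : StronglyMeasurable fun w => ∫ x, F (x, w) ∂(P.map V) :=
      hF.integral_prod_left'
    rw [← integral_map (f := fun w => ∫ x, F (x, w) ∂(P.map V)) hW hG.aestronglyMeasurable,
      ← integral_prod_symm F hFint, ← hVW.map_prod_eq_prod_map_map hV hW,
      integral_map (hV.prodMk hW) hF.aestronglyMeasurable]
  have hG1 : ∀ ω, ‖∫ x, F (x, W ω) ∂(P.map V)‖ ≤ 1 := by
    intro ω
    refine (norm_integral_le_of_norm_le_const (ae_of_all _ fun x => hF1 (x, W ω))).trans ?_
    simp
  have hGint : Integrable (fun ω => ∫ x, F (x, W ω) ∂(P.map V)) P := by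
    have hG : StronglyMeasurable fun w => ∫ x, F (x, w) ∂(P.map V) :=
      hF.integral_prod_left'
    exact (integrable_const (1 : ℝ)).mono' (hG.aestronglyMeasurable.comp_aemeasurable hW)
      (ae_of_all _ hG1)
  have e2 : ∫ ω, ∫ x, F (x, W ω) ∂(P.map V) ∂P - c =
      ∫ ω, (∫ x, F (x, W ω) ∂(P.map V) - c) ∂P := by
    rw [integral_sub hGint (integrable_const _)]
    simp
  rw [e1, e2]
  have hDm := measurableSet_toMeasurable P D
  have hind : Integrable ((toMeasurable P D).indicator fun _ => (2 : ℝ)) P :=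
    (integrable_const 2).indicator hDm
  refine (norm_integral_le_of_norm_le ((integrable_const e).fun_add hind) ?_).trans ?_
  · filter_upwards [h] with ω hω
    by_cases hD : ω ∈ toMeasurable P D
    · rw [Set.indicator_of_mem hD]
      have := norm_sub_le (∫ x, F (x, W ω) ∂(P.map V)) c
      have := hG1 ω
      linarith
    · rw [Set.indicator_of_notMem hD, add_zero]
      exact hω fun h' => hD (subset_toMeasurable P D h')
  · rw [integral_add (integrable_const e) hind, integral_indicator hDm]
    simp [Measure.real, mul_comm]

lemma tendsto_div_of_tendsto_cube_div {J : ℕ → ℕ}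
    (h : Tendsto (fun n => (J n : ℝ) ^ 3 / n) atTop (𝓝 0)) :
    Tendsto (fun n => (J n : ℝ) / n) atTop (𝓝 0) := by
  refine squeeze_zero (fun n => by positivity) (fun n => ?_) h
  gcongr
  exact_mod_cast Nat.le_self_pow (by norm_num) (J n)

/-! ### The central limit theorem -/

theorem mainTheorem1
    {Ω : ℕ → Type*} [∀ n, MeasurableSpace (Ω n)]
    (P : ∀ n, Measure (Ω n)) [∀ n, IsProbabilityMeasure (P n)]
    -- the vector `v` of i.i.d. variables with mean 0, variance 1 and bounded moment of order `s`
    (v : ∀ n, Fin n → Ω n → ℝ)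
    (hv_meas : ∀ n i, AEMeasurable (v n i) (P n))
    (hv_indep : ∀ n, iIndepFun (v n) (P n))
    (hv_ident : ∀ n i j, IdentDistrib (v n i) (v n j) (P n) (P n))
    (hv_mean : ∀ n i, ∫ ω, v n i ω ∂(P n) = 0)
    (hv_var : ∀ n i, variance (v n i) (P n) = 1)
    (s : ℝ) (hs : 8 ≤ s) (C : ℝ≥0)
    (hv_moment : ∀ n i, ∫⁻ ω, ‖v n i ω‖ₑ ^ s ∂(P n) ≤ C)
    -- the non-random matrix `B`, with uniformly bounded absolute row and column sums
    (B : ∀ n, Matrix (Fin n) (Fin n) ℝ) (CB : ℝ)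
    (hB_row : ∀ n i, ∑ j, |B n i j| ≤ CB)
    (hB_col : ∀ n j, ∑ i, |B n i j| ≤ CB)
    -- the symmetric matrix `S`, possibly random but independent of `v`
    (S : ∀ n, Ω n → Matrix (Fin n) (Fin n) ℝ)
    (hS_meas : ∀ n i j, AEMeasurable (fun ω => S n ω i j) (P n))
    (hS_symm : ∀ n, ∀ᵐ ω ∂(P n), (S n ω).IsSymm)
    (hS_indep : ∀ n, IndepFun (fun ω (i : Fin n) => v n i ω)
      (fun ω (p : Fin n × Fin n) => S n ω p.1 p.2) (P n))
    -- the matrix `A = B' S B`, a symmetric idempotent of rank `J`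
    (A : ∀ n, Ω n → Matrix (Fin n) (Fin n) ℝ)
    (hA : ∀ n, ∀ᵐ ω ∂(P n), A n ω = (B n)ᵀ * S n ω * B n)
    (hA_symm : ∀ n, ∀ᵐ ω ∂(P n), (A n ω).IsSymm)
    (hA_idem : ∀ n, ∀ᵐ ω ∂(P n), IsIdempotentElem (A n ω))
    (J : ℕ → ℕ)
    (hA_rank : ∀ n, ∀ᵐ ω ∂(P n), (A n ω).rank = J n)
    -- sizes of the entries, the column square sums and the largest eigenvalue of `S`
    (hS_entry : IsBigOInProbUnif P (I := fun n => Fin n × Fin n)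
      (fun n p ω => S n ω p.1 p.2) (fun n => (J n : ℝ) / n))
    (hS_col : IsBigOInProbUnif P (I := fun n => Fin n)
      (fun n j ω => ∑ i, (S n ω i j) ^ 2) (fun n => (J n : ℝ) / n))
    (hS_eig : IsBigOInProb P (fun n ω => largestEigenvalue (S n ω)) (fun _ => 1))
    -- `1 / J + J ^ 3 / n → 0`
    (hJ : Tendsto J atTop atTop)
    (hJn : Tendsto (fun n => (J n : ℝ) ^ 3 / n) atTop (𝓝 0)) :
    TendstoInDistribution
      (fun n ω => ((fun i => v n i ω) ⬝ᵥ (A n ω *ᵥ fun i => v n i ω) - (J n : ℝ)) /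
        Real.sqrt (2 * (J n : ℝ)))
      atTop (id : ℝ → ℝ) P (gaussianReal 0 1) := by
  -- the pair `(v, S)` and the quadratic form as a function of it
  set V : ∀ n, Ω n → Fin n → ℝ := fun n ω i => v n i ω with hVdef
  set W : ∀ n, Ω n → Fin n × Fin n → ℝ := fun n ω p => S n ω p.1 p.2 with hWdef
  set K : ∀ n, (Fin n × Fin n → ℝ) → Matrix (Fin n) (Fin n) ℝ :=
    fun n w => (B n)ᵀ * Matrix.of (fun i j => w (i, j)) * B n with hKdef
  have hKW : ∀ n ω, K n (W n ω) = (B n)ᵀ * S n ω * B n := fun n ω => rfl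
  have hq : ∀ n, Continuous fun p : (Fin n → ℝ) × (Fin n × Fin n → ℝ) =>
      p.1 ⬝ᵥ (K n p.2 *ᵥ p.1) := by
    intro n
    simp only [hKdef, dotProduct, Matrix.mulVec, Matrix.mul_apply, Matrix.of_apply]
    fun_prop
  have hVm : ∀ n, AEMeasurable (V n) (P n) := fun n => aemeasurable_pi_lambda _ (hv_meas n)
  have hWm : ∀ n, AEMeasurable (W n) (P n) :=
    fun n => aemeasurable_pi_lambda _ fun p => hS_meas n p.1 p.2
  have hXae : ∀ n, (fun ω => (V n ω ⬝ᵥ (K n (W n ω) *ᵥ V n ω) - (J n : ℝ)) / √(2 * (J n : ℝ)))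
      =ᵐ[P n] fun ω => ((fun i => v n i ω) ⬝ᵥ (A n ω *ᵥ fun i => v n i ω) - (J n : ℝ)) /
        √(2 * (J n : ℝ)) := by
    intro n
    filter_upwards [hA n] with ω hω
    rw [hKW, ← hω]
  have hXm : ∀ n, AEMeasurable (fun ω => (V n ω ⬝ᵥ (K n (W n ω) *ᵥ V n ω) - (J n : ℝ)) /
      √(2 * (J n : ℝ))) (P n) := by
    intro n
    have := (hq n).measurable.comp_aemeasurable ((hVm n).prodMk (hWm n))
    exact (this.sub_const _).div_const _
  refine TendstoInDistribution.congr hXae (EventuallyEq.refl _ _) ⟨hXm, aemeasurable_id, ?_⟩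
  refine ProbabilityMeasure.tendsto_of_tendsto_charFun fun t => ?_
  -- by Lévy's theorem it suffices to treat the characteristic functions
  have hlim : charFun ((gaussianReal 0 1).map id) t = Complex.exp (-(t : ℂ) ^ 2 / 2) := by
    rw [Measure.map_id, charFun_gaussianReal]
    simp [neg_div]
  simp only [ProbabilityMeasure.coe_mk, hlim]
  set c := Complex.exp (-(t : ℂ) ^ 2 / 2) with hc
  have hc1 : ‖c‖ ≤ 1 := by
    rw [hc, Complex.norm_exp, Real.exp_le_one_iff]
    rw [show (-(t : ℂ) ^ 2 / 2) = ((-t ^ 2 / 2 : ℝ) : ℂ) by push_cast; rfl, Complex.ofReal_re]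
    nlinarith [sq_nonneg t]
  set θ : ℕ → ℝ := fun n => t / √(2 * (J n : ℝ)) with hθ
  set F : ∀ n, (Fin n → ℝ) × (Fin n × Fin n → ℝ) → ℂ := fun n p =>
    Complex.exp ((-(θ n * J n) : ℝ) * Complex.I) * cexpQuadForm (K n p.2) (θ n) p.1 with hF
  have hFc : ∀ n, Continuous (F n) := by
    intro n
    have := hq n
    simp only [hF, cexpQuadForm]
    fun_prop
  have hF1 : ∀ n p, ‖F n p‖ ≤ 1 := by
    intro n p
    simp only [hF, cexpQuadForm]
    rw [norm_mul, Complex.norm_exp_ofReal_mul_I, Complex.norm_exp_ofReal_mul_I, one_mul]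
  have hchar : ∀ n, charFun ((P n).map fun ω =>
      (V n ω ⬝ᵥ (K n (W n ω) *ᵥ V n ω) - (J n : ℝ)) / √(2 * (J n : ℝ))) t =
      ∫ ω, F n (V n ω, W n ω) ∂(P n) := by
    intro n
    rw [charFun_apply_real, integral_map (hXm n) (Continuous.aestronglyMeasurable (by fun_prop))]
    refine integral_congr_ae (ae_of_all _ fun ω => ?_)
    simp only [hF, hθ, cexpQuadForm]
    rw [← Complex.exp_add, ← add_mul, ← Complex.ofReal_add, ← Complex.ofReal_mul]
    congr 3
    ring
  simp_rw [hchar]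
  obtain ⟨Mγ, hγ⟩ := exists_stdMoments_gaussianReal
  set M : ℝ := max (1 + C) Mγ with hM
  have hρ : ∀ n i, StdMoments M ((P n).map (v n i)) := fun n i =>
    (stdMoments_map (hv_meas n i) (hv_mean n i) (hv_var n i) (by linarith)
      (hv_moment n i)).mono (le_max_left _ _)
  have hγM : StdMoments M (gaussianReal 0 1) := hγ.mono (le_max_right _ _)
  have hmapV : ∀ n, (P n).map (V n) = Measure.pi fun i => (P n).map (v n i) := fun n =>
    (hv_indep n).map_fun_eq_pi_map (hv_meas n)
  have hJn0 := tendsto_div_of_tendsto_cube_div hJn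
  rw [Metric.tendsto_nhds]
  intro ε hε
  obtain ⟨m, hm⟩ := hS_entry (ENNReal.ofReal (ε / 4)) (ENNReal.ofReal_pos.2 (by linarith))
  -- the added ones only keep `η n` positive
  set η : ℕ → ℝ := fun n => (|m| + 1) * (CB ^ 2 + 1) * ((J n : ℝ) / n) with hη
  have hη0 : Tendsto η atTop (𝓝 0) := by
    simpa using hJn0.const_mul ((|m| + 1) * (CB ^ 2 + 1))
  set g : ℕ → ℝ := fun n =>
    512 * M ^ 2 * (t ^ 2 / 2 * (η n + √(η n)) + |t| * (t ^ 2 / 2) * (η n ^ 2 + √(η n))) +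
      ‖Complex.exp ((-(θ n * J n) : ℝ) * Complex.I) *
        (∫ y, Complex.exp ((θ n * y ^ 2 : ℝ) * Complex.I) ∂(gaussianReal 0 1)) ^ (J n) - c‖ with hg
  have hg0 : Tendsto g atTop (𝓝 0) := by
    have h1 : Tendsto (fun x : ℝ => 512 * M ^ 2 * (t ^ 2 / 2 * (x + √x) +
        |t| * (t ^ 2 / 2) * (x ^ 2 + √x))) (𝓝 0) (𝓝 0) := by
      have : Continuous fun x : ℝ => 512 * M ^ 2 * (t ^ 2 / 2 * (x + √x) +
        |t| * (t ^ 2 / 2) * (x ^ 2 + √x)) := by fun_prop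
      simpa using this.tendsto 0
    have h2 := ((tendsto_charFun_chiSq t).sub_const c).norm.comp hJ
    rw [hc, sub_self, norm_zero] at h2
    have h3 := (h1.comp hη0).add h2
    rw [add_zero] at h3
    exact h3
  filter_upwards [hm, hg0.eventually_lt_const (half_pos hε), hJ.eventually_ge_atTop 1,
    eventually_ge_atTop 1] with n hmn hgn hJ1 hn1
  have hJpos : (0 : ℝ) < J n := by exact_mod_cast hJ1
  have hnpos : (0 : ℝ) < n := by exact_mod_cast hn1
  have hηpos : 0 < η n := by positivity
  have hgnn : 0 ≤ g n := by positivity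
  rw [dist_eq_norm]
  -- the event of large entries of `S`, off which the estimate for a fixed projection applies
  set D : Set (Ω n) := {ω | ∃ i : Fin n × Fin n, m * ((J n : ℝ) / n) < |S n ω i.1 i.2|} with hD
  have hPD : ((P n) D).toReal ≤ ε / 4 := ENNReal.toReal_le_of_le_ofReal (by linarith) hmn
  have hfin := norm_integral_sub_le_of_indepFun (hVm n) (hWm n) (hS_indep n)
    (hFc n).stronglyMeasurable (hF1 n) hc1 (D := D) hgnn ?_
  · linarith
  filter_upwards [hA n, hA_symm n, hA_idem n, hA_rank n] with ω h1 h2 h3 h4 hωD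
  rw [h1] at h2 h3 h4
  have hbd : ∀ i j, |S n ω i j| ≤ |m| * ((J n : ℝ) / n) := by
    intro i j
    have : |S n ω i j| ≤ m * ((J n : ℝ) / n) := by
      by_contra! hlt
      exact hωD ⟨(i, j), hlt⟩
    refine this.trans ?_
    gcongr
    exact le_abs_self m
  have hdiag : ∀ i, ((B n)ᵀ * S n ω * B n) i i ≤ η n := by
    intro i
    refine (diag_conj_le (hB_col n) hbd i).trans ?_
    have : CB ^ 2 * |m| ≤ (|m| + 1) * (CB ^ 2 + 1) := by
      nlinarith [abs_nonneg m, sq_nonneg CB]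
    calc CB ^ 2 * (|m| * ((J n : ℝ) / n)) = CB ^ 2 * |m| * ((J n : ℝ) / n) := by ring
      _ ≤ (|m| + 1) * (CB ^ 2 + 1) * ((J n : ℝ) / n) := by gcongr
  have := norm_integral_standardized_sub_le h2 h3 hηpos hdiag h4 hJ1 t (hρ n) hγM
  rw [hmapV]
  simp only [hF]
  rw [integral_const_mul]
  exact this
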